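/- Let $q$ be a prime power with $q \equiv 1 \pmod 4$, let $\mathbb{F}_q$ be the field with $q$ elements, and let $\zeta$ be a primitive root of $\mathbb{F}_q$, i.e. a generator of the cyclic group $\mathbb{F}_q^\times$ (equivalently, an element of multiplicative order $q-1$). The SlimFly graph $\mathrm{SF}(q)$ is the simple undirected graph with vertex set $\{0,1\}\times\mathbb{F}_q\times\mathbb{F}_q$ and the following edges: 1. $\{(0,x,y),(0,x,y')\}$, where $y-y'=\zeta^i$ for some even $i \ge 0$; 2. $\{(1,m,c),(1,m,c')\}$, where $c-c'=\zeta^j$ for some odd $j \ge 0$; 3. $\{(0,x,y),(1,m,c)\}$, where $y=mx+c$. Then the algebraic connectivity of $\mathrm{SF}(q)$ is exactly $q$. Here the algebraic connectivity of a finite graph is the second smallest eigenvalue, counted with multiplicity, of its Laplacian matrix $L=D-A$, where $A$ is the adjacency matrix and $D$ the diagonal matrix of vertex degrees. -/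

import Mathlib

/-- The *algebraic connectivity* of a finite graph with at least two vertices: the second smallest
eigenvalue, counted with multiplicity, of its Laplacian matrix. Mathlib lists the `n` eigenvalues
of a Hermitian matrix in decreasing order, at the indices `0, …, n - 1`, so that the second
smallest one has index `n - 2`. -/
noncomputable def algebraicConnectivity {V : Type*} [Fintype V] [DecidableEq V] [Nontrivial V]
    (G : SimpleGraph V) [DecidableRel G.Adj] : ℝ :=
  (G.isHermitian_lapMatrix ℝ).eigenvalues₀
    ⟨Fintype.card V - 2, Nat.sub_lt Fintype.card_pos Nat.two_pos⟩

/-- The three kinds of edges of the SlimFly graph, each edge written in one of its directions: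
`(0, x, y) — (0, x, y')` where `y - y'` is an even power of `ζ`,
`(1, m, c) — (1, m, c')` where `c - c'` is an odd power of `ζ`, and
`(0, x, y) — (1, m, c)` where `y = m x + c`. -/
inductive SlimFlyRel {F : Type*} [Field F] (ζ : F) : Fin 2 × F × F → Fin 2 × F × F → Prop
  | even (x y y' : F) (i : ℕ) (hi : Even i) (h : y - y' = ζ ^ i) :
      SlimFlyRel ζ (0, x, y) (0, x, y')
  | odd (m c c' : F) (j : ℕ) (hj : Odd j) (h : c - c' = ζ ^ j) :
      SlimFlyRel ζ (1, m, c) (1, m, c')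
  | cross (x y m c : F) (h : y = m * x + c) :
      SlimFlyRel ζ (0, x, y) (1, m, c)

/-- The SlimFly graph on `{0, 1} × F × F` for the primitive root `ζ` of the finite field `F`:
two different vertices are adjacent if one of the three rules holds in some direction. -/
def slimFly {F : Type*} [Field F] (ζ : F) : SimpleGraph (Fin 2 × F × F) :=
  SimpleGraph.fromRel (SlimFlyRel ζ)

/-! Let `χ` be the quadratic character. Since `q ≡ 1 (mod 4)`, it is even, so both fibre relations
(`χ = 1` and `χ = -1`) are symmetric. With `X` the convolution by `χ` on each fibre and `B` the
incidence operator, the Laplacian is `3q/2` minus half the fibre sum, `±X/2` and the incidence term.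

Suppose `L v = μ v` with `μ ≠ 0` and `μ < q`. Summing over fibres, where `X` contributes nothing,
forces every fibre sum to vanish. On such vectors `X² = q`, `B Bᵀ = q` and `X B = B X`. So `ν = 3q -
2μ`, an eigenvalue of the block operator `[[X, 2B], [2Bᵀ, -X]]`, satisfies `ν² = 5q` when the first
component is nonzero (`sq_eq_of_incidence_eigenvector`). But `ν > q ≥ 5` gives `ν² > 5q`, a
contradiction. The value `q` is attained by mean-zero functions of `x` alone, and connectedness
makes `0` a simple eigenvalue. -/

open Finset Matrix

/-- If every eigenvalue of the Laplacian is `0` or at least `c > 0`, its kernel consists of constant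
vectors and `c` is an eigenvalue, then the algebraic connectivity is `c`. -/
theorem algebraicConnectivity_eq_of_eigenvalues {V : Type*} [Fintype V] [DecidableEq V]
    [Nontrivial V] (G : SimpleGraph V) [DecidableRel G.Adj] {c : ℝ} (hc : 0 < c)
    (hmin : ∀ (μ : ℝ) (v : V → ℝ), v ≠ 0 → G.lapMatrix ℝ *ᵥ v = μ • v → μ = 0 ∨ c ≤ μ)
    (hker : ∀ v : V → ℝ, G.lapMatrix ℝ *ᵥ v = 0 → ∀ i j, v i = v j)
    (hex : ∃ v : V → ℝ, v ≠ 0 ∧ G.lapMatrix ℝ *ᵥ v = c • v) :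
    algebraicConnectivity G = c := by
  have hA := G.isHermitian_lapMatrix ℝ
  let e : Fin (Fintype.card V) ≃ V := Fintype.equivOfCardEq (Fintype.card_fin _)
  have he : ∀ k, hA.eigenvalues₀ k = hA.eigenvalues (e k) := fun k ↦ by
    simp [IsHermitian.eigenvalues, e]
  have hne : ∀ i, (hA.eigenvectorBasis i : V → ℝ) ≠ 0 := fun i h ↦ by
    refine hA.eigenvectorBasis.orthonormal.ne_zero i ?_
    ext j
    exact congrFun h j
  have hdich : ∀ k, hA.eigenvalues₀ k = 0 ∨ c ≤ hA.eigenvalues₀ k := fun k ↦ by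
    rw [he]
    exact hmin _ _ (hne _) (hA.mulVec_eigenvectorBasis _)
  -- Two nonzero constant vectors are never orthogonal.
  have huniq : ∀ k l, hA.eigenvalues₀ k = 0 → hA.eigenvalues₀ l = 0 → k = l := by
    intro k l hk hl
    by_contra hkl
    rw [he] at hk hl
    have horth : inner ℝ (hA.eigenvectorBasis (e k)) (hA.eigenvectorBasis (e l)) = 0 :=
      hA.eigenvectorBasis.orthonormal.2 (fun h ↦ hkl (e.injective h))
    have h1 := hker _ (by rw [hA.mulVec_eigenvectorBasis (e k), hk, zero_smul])
    have h2 := hker _ (by rw [hA.mulVec_eigenvectorBasis (e l), hl, zero_smul])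
    have hz : ∀ i, ∃ j, (hA.eigenvectorBasis i : V → ℝ) j ≠ 0 := fun i ↦ by
      by_contra! h
      exact hne i (funext h)
    obtain ⟨a, ha⟩ := hz (e k)
    obtain ⟨b, hb⟩ := hz (e l)
    rw [PiLp.inner_apply, sum_congr rfl (fun i _ ↦ by rw [h1 i a, h2 i b])] at horth
    simp [ha, hb] at horth
  have hattain : ∀ μ : ℝ, (∃ v : V → ℝ, v ≠ 0 ∧ G.lapMatrix ℝ *ᵥ v = μ • v) →
      ∃ k, hA.eigenvalues₀ k = μ := by
    rintro μ ⟨v, hv, hμ⟩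
    have : μ ∈ spectrum ℝ (G.lapMatrix ℝ) := by
      rw [← Matrix.spectrum_toLin']
      refine Module.End.HasEigenvalue.mem_spectrum
        (Module.End.hasEigenvalue_of_hasEigenvector (x := v) ⟨?_, hv⟩)
      rw [Module.End.mem_eigenspace_iff, Matrix.toLin'_apply, hμ]
    rw [hA.spectrum_real_eq_range_eigenvalues] at this
    obtain ⟨i, hi⟩ := this
    exact ⟨e.symm i, by rw [he, e.apply_symm_apply, hi]⟩
  obtain ⟨k, hk⟩ := hattain c hex
  obtain ⟨l, hl⟩ := hattain 0 ⟨fun _ ↦ 1, fun h ↦ by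
    simpa using congrFun h (Classical.arbitrary V), by
      rw [G.lapMatrix_mulVec_const_eq_zero, zero_smul]⟩
  have hanti := hA.eigenvalues₀_antitone
  have hcard : 1 < Fintype.card V := Fintype.one_lt_card
  let p : Fin (Fintype.card V) := ⟨Fintype.card V - 2, by omega⟩
  let r : Fin (Fintype.card V) := ⟨Fintype.card V - 1, by omega⟩
  have hpr : p ≠ r := fun h ↦ by
    have := congrArg Fin.val h
    simp only [p, r] at this
    omega
  have hr : ∀ j, j ≠ r → j ≤ p := fun j hj ↦ by
    have h1 : j.val ≠ Fintype.card V - 1 := fun h ↦ hj (Fin.ext h)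
    have h2 := j.isLt
    refine Fin.le_def.2 ?_
    simp only [p]
    omega
  have hlr : l = r := by
    by_contra h
    have h0 : hA.eigenvalues₀ r ≤ 0 := hl ▸ hanti (show l ≤ r by
      refine Fin.le_def.2 ?_
      have := l.isLt
      simp only [r]
      omega)
    exact h (huniq _ _ hl ((hdich r).resolve_right (by linarith)))
  have hkp : k ≤ p := hr k fun h ↦ by
    rw [h, ← hlr, hl] at hk
    exact hc.ne hk
  change hA.eigenvalues₀ p = c
  -- The value `c` occurs at some index `k ≤ p`, which bounds entry `p` above; entry `p` is nonzero
  -- because `0` occurs only at the last index.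
  refine le_antisymm (hk ▸ hanti hkp) ((hdich p).resolve_left fun h ↦ hpr ?_)
  rw [← hlr]
  exact huniq _ _ h hl

theorem SimpleGraph.lapMatrix_mulVec_apply_eq_sum {V : Type*} [Fintype V] [DecidableEq V]
    (G : SimpleGraph V) [DecidableRel G.Adj] (v : V → ℝ) (i : V) :
    (G.lapMatrix ℝ *ᵥ v) i = ∑ j, if G.Adj i j then v i - v j else 0 := by
  rw [G.lapMatrix_mulVec_apply, G.degree_eq_sum_if_adj, sum_mul, G.neighborFinset_eq_filter,
    sum_filter, ← sum_sub_distrib]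
  refine sum_congr rfl fun j _ ↦ ?_
  split_ifs <;> simp

theorem ringChar_ne_two_of_card_mod_four {F : Type*} [Field F] [Fintype F]
    (hq : Fintype.card F % 4 = 1) : ringChar F ≠ 2 := by
  intro h
  have := FiniteField.even_card_of_char_two h
  omega

/-! ### Quadratic character and Paley convolution. -/

section QuadraticChar

variable {F : Type*} [Field F] [Fintype F] [DecidableEq F]

theorem quadraticChar_neg_of_card_mod_four (hq : Fintype.card F % 4 = 1) (a : F) :
    quadraticChar F (-a) = quadraticChar F a := by
  have h : quadraticChar F (-1) = 1 := by
    rw [quadraticChar_one_iff_isSquare (neg_ne_zero.2 one_ne_zero),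
      FiniteField.isSquare_neg_one_iff]
    omega
  rw [← neg_one_mul, map_mul, h, one_mul]

theorem sum_quadraticChar_cast (hq : Fintype.card F % 4 = 1) :
    ∑ a, (quadraticChar F a : ℝ) = 0 := by
  have := quadraticChar_sum_zero (ringChar_ne_two_of_card_mod_four hq)
  rw [← Int.cast_sum, this, Int.cast_zero]

/-- The autocorrelation of the quadratic character. -/
theorem sum_quadraticChar_mul (hq : Fintype.card F % 4 = 1) (y w : F) :
    ∑ z, quadraticChar F (y - z) * quadraticChar F (z - w) =
      (if y = w then (Fintype.card F : ℤ) else 0) - 1 := by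
  have h2 := ringChar_ne_two_of_card_mod_four hq
  split_ifs with h
  · subst h
    have : ∀ z, quadraticChar F (y - z) * quadraticChar F (z - y) =
        1 - if z = y then 1 else 0 := fun z ↦ by
      rw [← neg_sub z y, quadraticChar_neg_of_card_mod_four hq, ← sq]
      split_ifs with hz
      · simp [hz]
      · rw [quadraticChar_sq_one (sub_ne_zero.2 hz), sub_zero]
    simp only [this, sum_sub_distrib, sum_ite_eq', mem_univ, if_true]
    simp
  · have hyw : y - w ≠ 0 := sub_ne_zero.2 h
    have hJ := jacobiSum_nontrivial_inv (quadraticChar_ne_one h2)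
    rw [(quadraticChar_isQuadratic F).inv, quadraticChar_neg_of_card_mod_four hq, map_one,
      jacobiSum] at hJ
    rw [zero_sub, ← hJ]
    -- The substitution `z = (y - w) u + w` turns the sum into the Jacobi sum `J(χ, χ) = -χ(-1) =
    -- -1`.
    refine (((Equiv.mulLeft₀ _ hyw).trans (Equiv.addRight w)).sum_comp _).symm.trans ?_
    refine sum_congr rfl fun u _ ↦ ?_
    have e1 : y - ((y - w) * u + w) = (y - w) * (1 - u) := by ring
    have e2 : (y - w) * u + w - w = (y - w) * u := by ring
    change quadraticChar F (y - ((y - w) * u + w)) * quadraticChar F ((y - w) * u + w - w) = _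
    rw [e1, e2, map_mul, map_mul]
    linear_combination (quadraticChar F (1 - u) * quadraticChar F u) * quadraticChar_sq_one hyw

/-- Convolution with the quadratic character. -/
noncomputable def paleyConv (f : F → ℝ) (y : F) : ℝ := ∑ z, (quadraticChar F (y - z) : ℝ) * f z

theorem paleyConv_paleyConv (hq : Fintype.card F % 4 = 1) (f : F → ℝ) (y : F) :
    paleyConv (paleyConv f) y = Fintype.card F * f y - ∑ z, f z := by
  have h : ∀ w, ∑ z, (quadraticChar F (y - z) : ℝ) * (quadraticChar F (z - w) : ℝ) =
      (if y = w then (Fintype.card F : ℝ) else 0) - 1 := fun w ↦ by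
    have := sum_quadraticChar_mul hq y w
    split_ifs at this ⊢ <;> exact_mod_cast this
  simp only [paleyConv, mul_sum]
  rw [sum_comm]
  simp only [← mul_assoc, ← sum_mul, h, sub_mul, sum_sub_distrib, ite_mul, one_mul, zero_mul,
    sum_ite_eq, mem_univ, if_true]

theorem sum_paleyConv (hq : Fintype.card F % 4 = 1) (f : F → ℝ) : ∑ y, paleyConv f y = 0 := by
  simp only [paleyConv]
  rw [sum_comm]
  refine sum_eq_zero fun z _ ↦ ?_
  rw [← sum_mul, mul_eq_zero]
  exact Or.inl (((Equiv.subRight z).sum_comp fun u ↦ (quadraticChar F u : ℝ)).trans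
    (sum_quadraticChar_cast hq))

theorem paleyConv_const (hq : Fintype.card F % 4 = 1) (a : ℝ) (y : F) :
    paleyConv (fun _ ↦ a) y = 0 := by
  rw [paleyConv, ← sum_mul, mul_eq_zero]
  exact Or.inl (((Equiv.subLeft y).sum_comp fun u ↦ (quadraticChar F u : ℝ)).trans
    (sum_quadraticChar_cast hq))

theorem paleyConv_translate (f : F → ℝ) (a y : F) :
    paleyConv (fun z ↦ f (z - a)) y = paleyConv f (y - a) := by
  refine (Equiv.sum_comp (Equiv.addRight a) _).symm.trans (sum_congr rfl fun z _ ↦ ?_)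
  simp [sub_sub, add_comm]

/-- Off zero the indicator of `χ = 1` is `(1 + χ) / 2`; the discrepancy at `z = y` is harmless since
`f y - f z` vanishes there. -/
theorem sum_ite_quadraticChar_eq_one (hq : Fintype.card F % 4 = 1) (f : F → ℝ) (y : F) :
    ∑ z, (if quadraticChar F (y - z) = 1 then f y - f z else 0) =
      (Fintype.card F * f y - ∑ z, f z - paleyConv f y) / 2 := by
  have h : ∀ z, (if quadraticChar F (y - z) = 1 then f y - f z else 0) =
      (f y - f z + (quadraticChar F (y - z) * f y - quadraticChar F (y - z) * f z)) / 2 := by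
    intro z
    rcases eq_or_ne y z with rfl | hz
    · simp
    · rcases quadraticChar_dichotomy (sub_ne_zero.2 hz) with h | h <;> simp [h]
  have hc := paleyConv_const hq (f y) y
  simp only [h, ← sum_div, sum_add_distrib, sum_sub_distrib]
  rw [paleyConv] at hc ⊢
  rw [hc]
  simp
  ring

theorem sum_ite_quadraticChar_eq_neg_one (hq : Fintype.card F % 4 = 1) (f : F → ℝ) (y : F) :
    ∑ z, (if quadraticChar F (y - z) = -1 then f y - f z else 0) =
      (Fintype.card F * f y - ∑ z, f z + paleyConv f y) / 2 := by
  have h : ∀ z, (if quadraticChar F (y - z) = -1 then f y - f z else 0) =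
      (f y - f z - (quadraticChar F (y - z) * f y - quadraticChar F (y - z) * f z)) / 2 := by
    intro z
    rcases eq_or_ne y z with rfl | hz
    · simp
    · rcases quadraticChar_dichotomy (sub_ne_zero.2 hz) with h | h <;> norm_num [h]
      ring
  have hc := paleyConv_const hq (f y) y
  simp only [h, ← sum_div, sum_sub_distrib]
  rw [paleyConv] at hc ⊢
  rw [hc]
  simp

theorem exists_pow_eq_and_quadraticChar_pow (hq : Fintype.card F % 4 = 1) {ζ : F}
    (hζ : IsPrimitiveRoot ζ (Fintype.card F - 1)) :
    (∀ a : F, a ≠ 0 → ∃ i : ℕ, ζ ^ i = a) ∧ ∀ i : ℕ, quadraticChar F (ζ ^ i) = (-1) ^ i := by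
  have h2 := ringChar_ne_two_of_card_mod_four hq
  have hcard : 1 < Fintype.card F := Fintype.one_lt_card
  have : NeZero (Fintype.card F - 1) := ⟨by omega⟩
  have hpow : ∀ a : F, a ≠ 0 → ∃ i : ℕ, ζ ^ i = a := fun a ha ↦ by
    obtain ⟨i, -, hi⟩ := hζ.eq_pow_of_pow_eq_one (FiniteField.pow_card_sub_one_eq_one a ha)
    exact ⟨i, hi⟩
  refine ⟨hpow, fun i ↦ ?_⟩
  suffices h : quadraticChar F ζ = -1 by rw [map_pow, h]
  rcases quadraticChar_dichotomy (hζ.ne_zero (by omega)) with h | h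
  -- If `ζ` were a square, so would be all its powers, leaving no nonsquare.
  · obtain ⟨a, ha⟩ := quadraticChar_exists_neg_one h2
    obtain ⟨i, rfl⟩ := hpow a (by rintro rfl; simp at ha)
    rw [map_pow, h, one_pow] at ha
    norm_num at ha
  · exact h

theorem even_pow_iff_quadraticChar (hq : Fintype.card F % 4 = 1) {ζ : F}
    (hζ : IsPrimitiveRoot ζ (Fintype.card F - 1)) (a : F) :
    (∃ i, Even i ∧ a = ζ ^ i) ↔ quadraticChar F a = 1 := by
  obtain ⟨hpow, hχ⟩ := exists_pow_eq_and_quadraticChar_pow hq hζ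
  constructor
  · rintro ⟨i, hi, rfl⟩
    rw [hχ, hi.neg_one_pow]
  · intro h
    obtain ⟨i, rfl⟩ := hpow a (by rintro rfl; simp at h)
    rw [hχ, neg_one_pow_eq_one_iff_even (by norm_num)] at h
    exact ⟨i, h, rfl⟩

theorem odd_pow_iff_quadraticChar (hq : Fintype.card F % 4 = 1) {ζ : F}
    (hζ : IsPrimitiveRoot ζ (Fintype.card F - 1)) (a : F) :
    (∃ i, Odd i ∧ a = ζ ^ i) ↔ quadraticChar F a = -1 := by
  obtain ⟨hpow, hχ⟩ := exists_pow_eq_and_quadraticChar_pow hq hζ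
  constructor
  · rintro ⟨i, hi, rfl⟩
    rw [hχ, hi.neg_one_pow]
  · intro h
    obtain ⟨i, rfl⟩ := hpow a (by rintro rfl; simp at h)
    rw [hχ, neg_one_pow_eq_neg_one_iff_odd (by norm_num)] at h
    exact ⟨i, h, rfl⟩

/-- The block of an eigenvector equation `ν f = X f + 2 B g`, `ν g = - X g + 2 Bᵀ f` forces
`ν² ∈ {q, 5 q}`. -/
theorem sq_eq_of_incidence_eigenvector (hq : Fintype.card F % 4 = 1) {ν : ℝ}
    {f g : F → F → ℝ}
    (hf0 : ∀ x, ∑ y, f x y = 0) (hg0 : ∀ m, ∑ c, g m c = 0)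
    (hf : ∀ x y, ν * f x y = paleyConv (f x) y + 2 * ∑ m, g m (y - m * x))
    (hg : ∀ m c, ν * g m c = -paleyConv (g m) c + 2 * ∑ x, f x (m * x + c))
    (hne : (∃ x y, f x y ≠ 0) ∨ ∃ m c, g m c ≠ 0) :
    ν ^ 2 = Fintype.card F ∨ ν ^ 2 = 5 * Fintype.card F := by
  -- This is `B Bᵀ = q`: for `x' ≠ x` the map `m ↦ m (x' - x) + y` is a bijection, so the fibre sum
  -- `0` appears; only `x' = x` survives.
  have hBB : ∀ x y, ∑ m, ∑ x', f x' (m * x' + (y - m * x)) = Fintype.card F * f x y := by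
    intro x y
    rw [sum_comm, sum_eq_single x]
    · simp
    · intro x' _ hx
      refine Eq.trans (sum_congr rfl fun m _ ↦ ?_)
        ((((Equiv.mulRight₀ _ (sub_ne_zero.2 hx)).trans (Equiv.addRight y)).sum_comp
          (f x')).trans (hf0 x'))
      congr 1
      change _ = m * (x' - x) + y
      ring
    · simp
  have key : ∀ x y, ν ^ 2 * f x y = 5 * Fintype.card F * f x y := by
    intro x y
    -- `X` applied to the first equation. Convolution commutes with translations, hence with `B`, so
    -- the mixed terms of `e1` and `e2` cancel.
    have e1 : ν * paleyConv (f x) y = Fintype.card F * f x y +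
        2 * ∑ m, paleyConv (g m) (y - m * x) := by
      have h := paleyConv_paleyConv hq (f x) y
      rw [hf0, sub_zero] at h
      have h3 : ∑ m, paleyConv (g m) (y - m * x) =
          paleyConv (fun z ↦ ∑ m, g m (z - m * x)) y := by
        rw [sum_congr rfl fun m _ ↦ (paleyConv_translate (g m) (m * x) y).symm]
        simp only [paleyConv, mul_sum]
        exact sum_comm
      rw [← h, h3]
      simp only [paleyConv, mul_sum (a := ν), mul_left_comm ν, hf]
      simp only [mul_add, sum_add_distrib]
      congr 1
      rw [mul_sum]
      exact sum_congr rfl fun _ _ ↦ by ring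
    have e2 : ν * ∑ m, g m (y - m * x) = -∑ m, paleyConv (g m) (y - m * x) +
        2 * (Fintype.card F * f x y) := by
      rw [← hBB, mul_sum, mul_sum, ← sum_neg_distrib, ← sum_add_distrib]
      exact sum_congr rfl fun m _ ↦ hg m _
    linear_combination ν * hf x y + e1 + 2 * e2
  by_cases h : ∃ x y, f x y ≠ 0
  · obtain ⟨x, y, hxy⟩ := h
    exact Or.inr (mul_right_cancel₀ hxy (key x y))
  -- With `f = 0` the second equation reads `ν g = -X g`, and `X² = q` suffices; this avoids
  -- computing `Bᵀ B`.
  · obtain ⟨m, c, hmc⟩ := hne.resolve_left h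
    push Not at h
    left
    have hg' : ∀ m c, ν * g m c = -paleyConv (g m) c := fun m c ↦ by rw [hg]; simp [h]
    refine mul_right_cancel₀ hmc ?_
    have h2 := paleyConv_paleyConv hq (g m) c
    rw [hg0, sub_zero] at h2
    have h3 : ν * paleyConv (g m) c = -paleyConv (paleyConv (g m)) c := by
      simp only [paleyConv, mul_sum (a := ν), mul_left_comm ν, hg', mul_neg, sum_neg_distrib]
    linear_combination ν * hg' m c - h3 + h2

end QuadraticChar

/-! ### Adjacency and Laplacian spectrum of the SlimFly graph. -/

theorem slimFly_adj_zero_one {F : Type*} [Field F] {ζ : F} (x y m c : F) :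
    (slimFly ζ).Adj (0, x, y) (1, m, c) ↔ y = m * x + c := by
  rw [slimFly, SimpleGraph.fromRel_adj]
  constructor
  · rintro ⟨-, h | h⟩
    · cases h with
      | cross _ _ _ _ h => exact h
    · cases h
  · exact fun h ↦ ⟨by simp, Or.inl (.cross x y m c h)⟩

section SlimFly

variable {F : Type*} [Field F] [Fintype F] [DecidableEq F] {ζ : F}

theorem slimFly_adj_zero_zero (hq : Fintype.card F % 4 = 1)
    (hζ : IsPrimitiveRoot ζ (Fintype.card F - 1)) (x y x' y' : F) :
    (slimFly ζ).Adj (0, x, y) (0, x', y') ↔ x = x' ∧ quadraticChar F (y - y') = 1 := by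
  rw [slimFly, SimpleGraph.fromRel_adj]
  constructor
  · rintro ⟨-, h | h⟩
    · cases h with
      | even _ _ _ i hi h => exact ⟨rfl, (even_pow_iff_quadraticChar hq hζ _).1 ⟨i, hi, h⟩⟩
    · cases h with
      | even _ _ _ i hi h =>
        rw [← neg_sub, quadraticChar_neg_of_card_mod_four hq]
        exact ⟨rfl, (even_pow_iff_quadraticChar hq hζ _).1 ⟨i, hi, h⟩⟩
  · rintro ⟨rfl, h⟩
    obtain ⟨i, hi, h'⟩ := (even_pow_iff_quadraticChar hq hζ _).2 h
    refine ⟨?_, Or.inl (.even x y y' i hi h')⟩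
    rintro heq
    simp only [Prod.mk.injEq, true_and] at heq
    simp [heq] at h

theorem slimFly_adj_one_one (hq : Fintype.card F % 4 = 1)
    (hζ : IsPrimitiveRoot ζ (Fintype.card F - 1)) (m c m' c' : F) :
    (slimFly ζ).Adj (1, m, c) (1, m', c') ↔ m = m' ∧ quadraticChar F (c - c') = -1 := by
  rw [slimFly, SimpleGraph.fromRel_adj]
  constructor
  · rintro ⟨-, h | h⟩
    · cases h with
      | odd _ _ _ i hi h => exact ⟨rfl, (odd_pow_iff_quadraticChar hq hζ _).1 ⟨i, hi, h⟩⟩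
    · cases h with
      | odd _ _ _ i hi h =>
        rw [← neg_sub, quadraticChar_neg_of_card_mod_four hq]
        exact ⟨rfl, (odd_pow_iff_quadraticChar hq hζ _).1 ⟨i, hi, h⟩⟩
  · rintro ⟨rfl, h⟩
    obtain ⟨i, hi, h'⟩ := (odd_pow_iff_quadraticChar hq hζ _).2 h
    refine ⟨?_, Or.inl (.odd m c c' i hi h')⟩
    rintro heq
    simp only [Prod.mk.injEq, true_and] at heq
    simp [heq] at h

variable [DecidableRel (slimFly ζ).Adj]

theorem slimFly_lapMatrix_mulVec_zero (hq : Fintype.card F % 4 = 1)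
    (hζ : IsPrimitiveRoot ζ (Fintype.card F - 1)) (v : Fin 2 × F × F → ℝ) (x y : F) :
    ((slimFly ζ).lapMatrix ℝ *ᵥ v) (0, x, y) = 3 * Fintype.card F / 2 * v (0, x, y) -
      (∑ z, v (0, x, z) + paleyConv (fun z ↦ v (0, x, z)) y) / 2 -
      ∑ m, v (1, m, y - m * x) := by
  rw [SimpleGraph.lapMatrix_mulVec_apply_eq_sum]
  simp only [Fintype.sum_prod_type, Fin.sum_univ_two, slimFly_adj_zero_zero hq hζ,
    slimFly_adj_zero_one, ite_and]
  have h1 : ∀ m c, (if y = m * x + c then v (0, x, y) - v (1, m, c) else 0) =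
      if y - m * x = c then v (0, x, y) - v (1, m, c) else 0 := fun m c ↦
    if_congr (by rw [sub_eq_iff_eq_add']) rfl rfl
  rw [sum_comm (γ := F)]
  simp only [h1, sum_ite_eq, mem_univ, if_true, sum_sub_distrib]
  rw [sum_ite_quadraticChar_eq_one hq (fun z ↦ v (0, x, z))]
  simp
  ring

theorem slimFly_lapMatrix_mulVec_one (hq : Fintype.card F % 4 = 1)
    (hζ : IsPrimitiveRoot ζ (Fintype.card F - 1)) (v : Fin 2 × F × F → ℝ) (m c : F) :
    ((slimFly ζ).lapMatrix ℝ *ᵥ v) (1, m, c) = 3 * Fintype.card F / 2 * v (1, m, c) -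
      (∑ z, v (1, m, z) - paleyConv (fun z ↦ v (1, m, z)) c) / 2 -
      ∑ x, v (0, x, m * x + c) := by
  rw [SimpleGraph.lapMatrix_mulVec_apply_eq_sum]
  simp only [Fintype.sum_prod_type, Fin.sum_univ_two, slimFly_adj_one_one hq hζ,
    (slimFly ζ).adj_comm (1, _, _) (0, _, _), slimFly_adj_zero_one, ite_and]
  rw [sum_comm (γ := F) (f := fun m' c' ↦ if m = m' then _ else _)]
  simp only [sum_ite_eq, sum_ite_eq', mem_univ, if_true, sum_sub_distrib]
  rw [sum_ite_quadraticChar_eq_neg_one hq (fun z ↦ v (1, m, z))]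
  simp
  ring

theorem slimFly_lapMatrix_eigenvalue (hq : Fintype.card F % 4 = 1)
    (hζ : IsPrimitiveRoot ζ (Fintype.card F - 1)) {μ : ℝ} {v : Fin 2 × F × F → ℝ} (hv : v ≠ 0)
    (h : (slimFly ζ).lapMatrix ℝ *ᵥ v = μ • v) : μ = 0 ∨ (Fintype.card F : ℝ) ≤ μ := by
  have h0 : ∀ x y, _ = μ * v (0, x, y) := fun x y ↦
    (slimFly_lapMatrix_mulVec_zero hq hζ v x y).symm.trans (congrFun h (0, x, y))
  have h1 : ∀ m c, _ = μ * v (1, m, c) := fun m c ↦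
    (slimFly_lapMatrix_mulVec_one hq hζ v m c).symm.trans (congrFun h (1, m, c))
  have hcard : 1 < Fintype.card F := Fintype.one_lt_card
  have h5 : (5 : ℝ) ≤ Fintype.card F := by exact_mod_cast (by omega : 5 ≤ Fintype.card F)
  rw [or_iff_not_imp_left]
  intro hμ
  by_contra! hlt
  set q : ℝ := (Fintype.card F : ℝ) with hqdef
  set s : F → ℝ := fun x ↦ ∑ y, v (0, x, y) with hs
  set t : F → ℝ := fun m ↦ ∑ c, v (1, m, c) with ht
  have hs1 : ∀ x, (q - μ) * s x = ∑ m, t m := fun x ↦ by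
    have e : ∑ y, ∑ m, v (1, m, y - m * x) = ∑ m, t m := by
      rw [sum_comm]
      exact sum_congr rfl fun m _ ↦ Equiv.sum_comp (Equiv.subRight (m * x)) fun c ↦ v (1, m, c)
    have := sum_congr rfl fun y (_ : y ∈ univ) ↦ h0 x y
    simp only [sum_sub_distrib, ← mul_sum, ← sum_div, sum_add_distrib, sum_paleyConv hq, e,
      sum_const, card_univ, nsmul_eq_mul] at this
    linear_combination this
  have ht1 : ∀ m, (q - μ) * t m = ∑ x, s x := fun m ↦ by
    have e : ∑ c, ∑ x, v (0, x, m * x + c) = ∑ x, s x := by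
      rw [sum_comm]
      exact sum_congr rfl fun x _ ↦ Equiv.sum_comp (Equiv.addLeft (m * x)) fun y ↦ v (0, x, y)
    have := sum_congr rfl fun c (_ : c ∈ univ) ↦ h1 m c
    simp only [sum_sub_distrib, ← mul_sum, ← sum_div, sum_paleyConv hq, e,
      sum_const, card_univ, nsmul_eq_mul] at this
    linear_combination this
  have hS : (q - μ) * ∑ x, s x = q * ∑ m, t m := by
    rw [mul_sum, sum_congr rfl fun x _ ↦ hs1 x]
    simp [hqdef]
  have hT : (q - μ) * ∑ m, t m = q * ∑ x, s x := by
    rw [mul_sum, sum_congr rfl fun m _ ↦ ht1 m]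
    simp [hqdef]
  have hqμ : 0 < q - μ := by linarith
  -- `(q - μ)² - q²`, up to sign the determinant of the system `hS`, `hT`.
  have hprod : μ * (μ - 2 * q) ≠ 0 := mul_ne_zero hμ (by linarith)
  have hS0 : ∑ x, s x = 0 := by
    refine (mul_eq_zero.1 (?_ : μ * (μ - 2 * q) * ∑ x, s x = 0)).resolve_left hprod
    linear_combination (q - μ) * hS + q * hT
  have hT0 : ∑ m, t m = 0 := by
    refine (mul_eq_zero.1 (?_ : μ * (μ - 2 * q) * ∑ m, t m = 0)).resolve_left hprod
    linear_combination (q - μ) * hT + q * hS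
  have hs0 : ∀ x, s x = 0 := fun x ↦
    (mul_eq_zero.1 ((hs1 x).trans hT0)).resolve_left hqμ.ne'
  have ht0 : ∀ m, t m = 0 := fun m ↦
    (mul_eq_zero.1 ((ht1 m).trans hS0)).resolve_left hqμ.ne'
  have hν := sq_eq_of_incidence_eigenvector hq (ν := 3 * q - 2 * μ)
    (f := fun x y ↦ v (0, x, y)) (g := fun m c ↦ v (1, m, c)) hs0 ht0
    (fun x y ↦ by
      have e1 := h0 x y
      have e2 : ∑ z, v (0, x, z) = 0 := hs0 x
      rw [e2] at e1
      linear_combination 2 * e1)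
    (fun m c ↦ by
      have e1 := h1 m c
      have e2 : ∑ z, v (1, m, z) = 0 := ht0 m
      rw [e2] at e1
      linear_combination 2 * e1)
    (by
      by_contra! hz
      refine hv (funext fun ⟨i, a, b⟩ ↦ ?_)
      fin_cases i
      · exact hz.1 a b
      · exact hz.2 a b)
  rcases hν with hν | hν <;> nlinarith

theorem slimFly_lapMatrix_ker {v : Fin 2 × F × F → ℝ}
    (h : (slimFly ζ).lapMatrix ℝ *ᵥ v = 0) (i j : Fin 2 × F × F) : v i = v j := by
  -- The cross edges alone connect the graph: slope `0` links all `x` at fixed `y`, and moving from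
  -- `x = 1` to `x = 0` along slope `y` reaches height `0`.
  rw [SimpleGraph.lapMatrix_mulVec_eq_zero_iff_forall_adj] at h
  have hc : ∀ x y m, v (0, x, y) = v (1, m, y - m * x) := fun x y m ↦
    h _ _ ((slimFly_adj_zero_one _ _ _ _).2 (by ring))
  have hx : ∀ x y, v (0, x, y) = v (0, 0, y) := fun x y ↦ by
    rw [hc x y 0, hc 0 y 0, zero_mul, zero_mul]
  have hy : ∀ y, v (0, 0, y) = v (0, 0, 0) := fun y ↦ by
    rw [← hx 1 y, hc 1 y y, hc 0 0 y, mul_one, mul_zero, sub_self, sub_zero]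
  have hall : ∀ k, v k = v (0, 0, 0) := by
    rintro ⟨k, a, b⟩
    fin_cases k
    · exact (hx a b).trans (hy b)
    · refine Eq.trans ?_ (hy b)
      rw [hc 0 b a, mul_zero, sub_zero]
      rfl
  rw [hall i, hall j]

theorem slimFly_exists_eigenvector (hq : Fintype.card F % 4 = 1)
    (hζ : IsPrimitiveRoot ζ (Fintype.card F - 1)) :
    ∃ v : Fin 2 × F × F → ℝ, v ≠ 0 ∧
      (slimFly ζ).lapMatrix ℝ *ᵥ v = (Fintype.card F : ℝ) • v := by
  let w : F → ℝ := fun x ↦ (quadraticChar F x : ℝ)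
  have hw : ∑ x, w x = 0 := sum_quadraticChar_cast hq
  -- Constant on fibres, so `X` kills it and the eigenvalue is `3q/2 - q/2`; mean zero in `x`, so
  -- the other side receives nothing.
  refine ⟨fun k ↦ if k.1 = 0 then w k.2.1 else 0, fun h ↦ ?_, ?_⟩
  · simpa [w] using congrFun h (0, 1, 0)
  · ext ⟨k, a, b⟩
    fin_cases k
    · refine (slimFly_lapMatrix_mulVec_zero hq hζ _ a b).trans ?_
      simp only [Fin.isValue, if_true, one_ne_zero, if_false, paleyConv_const hq]
      simp
      ring
    · refine (slimFly_lapMatrix_mulVec_one hq hζ _ a b).trans ?_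
      simp only [Fin.isValue, if_true, one_ne_zero, if_false, paleyConv_const hq, hw]
      simp

end SlimFly

theorem mainTheorem1 (q : ℕ) (hq : IsPrimePow q) (hq4 : q ≡ 1 [MOD 4])
    {F : Type*} [Field F] [Fintype F] [DecidableEq F] (hF : Fintype.card F = q)
    (ζ : F) (hζ : IsPrimitiveRoot ζ (q - 1)) [DecidableRel (slimFly ζ).Adj] :
    algebraicConnectivity (slimFly ζ) = q := by
  subst hF
  exact algebraicConnectivity_eq_of_eigenvalues _ (Nat.cast_pos.2 Fintype.card_pos)
    (fun _ _ ↦ slimFly_lapMatrix_eigenvalue hq4 hζ) (fun _ ↦ slimFly_lapMatrix_ker)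
    (slimFly_exists_eigenvector hq4 hζ)
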